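/- Let $M$ be a nonzero commutative von Neumann algebra (on a Hilbert space of arbitrary dimension), and let $D$ be a $\sigma$-finite von Neumann subalgebra of $M$ (containing the identity of $M$), where $\sigma$-finite means that every family of mutually orthogonal nonzero projections in $D$ is countable. Let $A$ be a weak* closed subalgebra of $M$ containing $D$, and let $\Phi : A \to D$ be a unital weak* continuous linear map which is a $D$-bimodule map, that is, $\Phi(d_1 a d_2) = d_1 \Phi(a) d_2$ for all $a \in A$ and $d_1, d_2 \in D$. ("Normal" means weak* continuous. A conditional expectation of $M$ onto $D$ is a positive contractive $D$-bimodule map $M \to D$ that restricts to the identity map on $D$.) Then the following are equivalent: 1. there is a normal conditional expectation of $M$ onto $D$ extending $\Phi$; 2. for some faithful normal state $\tau$ on $D$ there is a normal state $\psi_\tau$ on $M$ extending $\tau \circ \Phi$; 3. for every faithful normal state $\tau$ on $D$ there is a normal state $\psi_\tau$ on $M$ extending $\tau \circ \Phi$. -/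

import Mathlib

open scoped Topology ComplexOrder InnerProductSpace

namespace VonNeumannAlgebra

variable {H : Type*} [NormedAddCommGroup H] [InnerProductSpace ℂ H] [CompleteSpace H]

instance instSMulMemClass : SMulMemClass (VonNeumannAlgebra H) ℂ (H →L[ℂ] H) where
  smul_mem {s} c _ hx := s.toStarSubalgebra.smul_mem hx c

/-- The weak* (that is, ultraweak, or σ-weak) topology on `B(H)`: the coarsest topology for which
all functionals `T ↦ ∑ₙ ⟨yₙ, T xₙ⟩` with `∑ₙ ‖xₙ‖² < ∞` and `∑ₙ ‖yₙ‖² < ∞` are continuous. -/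
@[reducible] noncomputable def ultraweak (H : Type*) [NormedAddCommGroup H] [InnerProductSpace ℂ H] [CompleteSpace H] :
    TopologicalSpace (H →L[ℂ] H) :=
  ⨅ (x : lp (fun _ : ℕ => H) 2) (y : lp (fun _ : ℕ => H) 2),
    TopologicalSpace.induced (fun T : H →L[ℂ] H => ∑' n, ⟪y n, T (x n)⟫_ℂ) inferInstance

/-- The weak* topology on a subset `S` of `B(H)`: the one inherited from `B(H)`. For `S` a von
Neumann algebra, or any weak* closed subspace of `B(H)`, it is the weak* topology of `S`. -/
@[reducible] noncomputable def ultraweakOn {σ : Type*} [SetLike σ (H →L[ℂ] H)] (S : σ) : TopologicalSpace S :=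
  TopologicalSpace.induced (fun x : S => (x : H →L[ℂ] H)) (ultraweak H)

/-- A von Neumann algebra is σ-finite if every set of mutually orthogonal nonzero projections in it
is countable. -/
def IsSigmaFinite (M : VonNeumannAlgebra H) : Prop :=
  ∀ P : Set (H →L[ℂ] H), (∀ p ∈ P, p ∈ M ∧ IsStarProjection p ∧ p ≠ 0) →
    P.Pairwise (fun p q => p * q = 0) → P.Countable

/-- Normal states: unital positive weak* continuous functionals. -/
structure IsNormalState (M : VonNeumannAlgebra H) (φ : M →ₗ[ℂ] ℂ) : Prop where
  map_one : φ 1 = 1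
  map_nonneg : ∀ m : M, 0 ≤ (m : H →L[ℂ] H) → 0 ≤ φ m
  continuous : Continuous[ultraweakOn M, inferInstance] φ

/-- Faithful functionals: those that vanish at no nonzero positive element. -/
def IsFaithful (M : VonNeumannAlgebra H) (φ : M →ₗ[ℂ] ℂ) : Prop :=
  ∀ m : M, 0 ≤ (m : H →L[ℂ] H) → φ m = 0 → m = 0

/-- Normal conditional expectations of `M` onto a von Neumann subalgebra `D`: positive contractive
weak* continuous `D`-bimodule maps `M → D` that restrict to the identity map on `D`. -/
structure IsNormalCondExp (M D : VonNeumannAlgebra H) (hDM : D ≤ M) (E : M →ₗ[ℂ] D) : Prop where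
  map_coe : ∀ d : D, E ⟨d, hDM d.2⟩ = d
  map_nonneg : ∀ m : M, 0 ≤ (m : H →L[ℂ] H) → 0 ≤ (E m : H →L[ℂ] H)
  norm_map_le : ∀ m : M, ‖(E m : H →L[ℂ] H)‖ ≤ ‖(m : H →L[ℂ] H)‖
  map_mul_mul : ∀ (d₁ d₂ : D) (m : M), E (⟨d₁, hDM d₁.2⟩ * m * ⟨d₂, hDM d₂.2⟩) = d₁ * E m * d₂
  continuous : Continuous[ultraweakOn M, ultraweakOn D] E

end VonNeumannAlgebra

namespace VonNeumannAlgebra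

open Filter

set_option linter.unusedSectionVars false

variable {H : Type*} [NormedAddCommGroup H] [InnerProductSpace ℂ H] [CompleteSpace H]
variable {ι κ : Type*}

/-! If `E` is a normal expectation extending `Φ`, then `τ ∘ E` is a normal state extending `τ ∘ Φ`,
for any normal state `τ`. σ-finiteness of `D` serves only to supply a faithful normal `τ`
(`exists_faithful_normalState`).

Conversely, let `ψ` extend `τ ∘ Φ` with `τ` faithful. As `Φ` is a unital bimodule map, it fixes `D`,
so `ψ` restricts to `τ` there. For `m` in `M`, commutativity gives `|ψ(s t m)| ≤ ‖m‖ ψ(s)` for `s ≥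
0` and `‖t‖ ≤ 1` in `D`, so a Radon–Nikodym theorem (`exists_radon_nikodym`) yields `E m` in `D`
with `ψ(d m) = τ(d E(m))` for all `d` and `‖E m‖ ≤ ‖m‖`. Faithfulness makes `E m` unique, and
uniqueness gives linearity, the bimodule property, and `E = Φ` on `A`, because `ψ(d a) = τ(Φ(d a)) =
τ(d Φ(a))`.

For normality of `E`, note that `τ(e E(·)) = ψ(e ·)` is normal, and that the functionals `τ(e ·)`
are norm dense among the normal functionals on `D` (`exists_norm_vecFun_sub_le`). The limit is
realised as a vector functional by a telescoping series (`exists_vecFun_comp`).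

Normal functionals are handled throughout as `T ↦ ⟨y, T x⟩` with `x`, `y` in `ℓ²(H)`. -/

theorem memℓp_two_iff (x : ι → H) : Memℓp x 2 ↔ Summable fun i => ‖x i‖ ^ 2 := by
  rw [memℓp_gen_iff (by norm_num)]
  norm_num

theorem summable_norm_sq (x : lp (fun _ : ι => H) 2) : Summable fun i => ‖x i‖ ^ 2 :=
  (memℓp_two_iff _).1 (lp.memℓp x)

theorem hasSum_norm_sq (x : lp (fun _ : ι => H) 2) : HasSum (fun i => ‖x i‖ ^ 2) (‖x‖ ^ 2) := by
  have := lp.hasSum_norm (p := 2) (by norm_num) x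
  norm_num at this
  exact this

/-! ### Vector functionals and weak* continuity. -/

/-- The action of an operator on `ℓ²(ι, H)`, coordinate by coordinate. -/
noncomputable def amp (T : H →L[ℂ] H) (x : lp (fun _ : ι => H) 2) : lp (fun _ : ι => H) 2 :=
  ⟨fun i => T (x i), (memℓp_two_iff _).2 <| by
    refine .of_nonneg_of_le (fun _ => by positivity) (fun i => ?_)
      ((summable_norm_sq x).mul_left (‖T‖ ^ 2))
    rw [← mul_pow]
    exact pow_le_pow_left₀ (norm_nonneg _) (T.le_opNorm _) 2⟩

@[simp] theorem amp_apply (T : H →L[ℂ] H) (x : lp (fun _ : ι => H) 2) (i : ι) :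
    amp T x i = T (x i) := rfl

theorem amp_add_left (S T : H →L[ℂ] H) (x : lp (fun _ : ι => H) 2) :
    amp (S + T) x = amp S x + amp T x := by ext i; simp

theorem amp_smul_left (c : ℂ) (T : H →L[ℂ] H) (x : lp (fun _ : ι => H) 2) :
    amp (c • T) x = c • amp T x := by ext i; simp

theorem amp_add_right (T : H →L[ℂ] H) (x y : lp (fun _ : ι => H) 2) :
    amp T (x + y) = amp T x + amp T y := by ext i; simp

theorem amp_sub_right (T : H →L[ℂ] H) (x y : lp (fun _ : ι => H) 2) :
    amp T (x - y) = amp T x - amp T y := by ext i; simp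

theorem amp_smul_right (c : ℂ) (T : H →L[ℂ] H) (x : lp (fun _ : ι => H) 2) :
    amp T (c • x) = c • amp T x := by ext i; simp

theorem amp_mul (S T : H →L[ℂ] H) (x : lp (fun _ : ι => H) 2) :
    amp (S * T) x = amp S (amp T x) := by ext i; simp

@[simp] theorem amp_one (x : lp (fun _ : ι => H) 2) : amp 1 x = x := by ext i; simp

theorem norm_amp_le (T : H →L[ℂ] H) (x : lp (fun _ : ι => H) 2) : ‖amp T x‖ ≤ ‖T‖ * ‖x‖ := by
  refine abs_le_of_sq_le_sq' ?_ (by positivity) |>.2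
  rw [mul_pow]
  refine hasSum_le (fun i => ?_) (hasSum_norm_sq _) ((hasSum_norm_sq x).mul_left _)
  rw [← mul_pow]
  exact pow_le_pow_left₀ (norm_nonneg _) (T.le_opNorm _) 2

theorem inner_amp_left (T : H →L[ℂ] H) (x y : lp (fun _ : ι => H) 2) :
    ⟪amp T y, x⟫_ℂ = ⟪y, amp (star T) x⟫_ℂ := by
  rw [lp.inner_eq_tsum, lp.inner_eq_tsum]
  refine tsum_congr fun i => ?_
  simp [ContinuousLinearMap.star_eq_adjoint, ContinuousLinearMap.adjoint_inner_right]

/-- The functional `T ↦ ∑ᵢ ⟨yᵢ, T xᵢ⟩` on `B(H)`. -/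
noncomputable def vecFun (y x : lp (fun _ : ι => H) 2) : (H →L[ℂ] H) →L[ℂ] ℂ :=
  LinearMap.mkContinuous
    { toFun := fun T => ⟪y, amp T x⟫_ℂ
      map_add' := fun S T => by rw [amp_add_left, inner_add_right]
      map_smul' := fun c T => by rw [amp_smul_left, inner_smul_right]; rfl }
    (‖y‖ * ‖x‖) fun T => by
      refine (norm_inner_le_norm (𝕜 := ℂ) y (amp T x)).trans ?_
      rw [mul_assoc, mul_comm ‖x‖]
      exact mul_le_mul_of_nonneg_left (norm_amp_le _ _) (norm_nonneg _)

theorem vecFun_apply (y x : lp (fun _ : ι => H) 2) (T : H →L[ℂ] H) :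
    vecFun y x T = ⟪y, amp T x⟫_ℂ := rfl

theorem hasSum_vecFun (y x : lp (fun _ : ι => H) 2) (T : H →L[ℂ] H) :
    HasSum (fun i => ⟪y i, T (x i)⟫_ℂ) (vecFun y x T) :=
  lp.hasSum_inner y (amp T x)

theorem vecFun_eq_tsum (y x : lp (fun _ : ι => H) 2) (T : H →L[ℂ] H) :
    vecFun y x T = ∑' i, ⟪y i, T (x i)⟫_ℂ := (hasSum_vecFun y x T).tsum_eq.symm

theorem vecFun_star (y x : lp (fun _ : ι => H) 2) (T : H →L[ℂ] H) :
    vecFun y x (star T) = star (vecFun x y T) := by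
  rw [vecFun_apply, vecFun_apply, ← inner_amp_left]
  exact (inner_conj_symm _ _).symm

theorem vecFun_star_mul_self (x : lp (fun _ : ι => H) 2) (T : H →L[ℂ] H) :
    vecFun x x (star T * T) = (‖amp T x‖ : ℂ) ^ 2 := by
  rw [vecFun_apply, amp_mul, ← inner_amp_left, inner_self_eq_norm_sq_to_K]
  rfl

theorem vecFun_nonneg (x : lp (fun _ : ι => H) 2) {T : H →L[ℂ] H} (hT : 0 ≤ T) :
    0 ≤ vecFun x x T := by
  rw [vecFun_eq_tsum]
  exact tsum_nonneg fun i =>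
    ((ContinuousLinearMap.nonneg_iff_isPositive T).1 hT).inner_nonneg_right _

/-- Vector functionals indexed by a countable set can be indexed by `ℕ`. -/
theorem exists_vecFun_nat [Countable ι] (y x : lp (fun _ : ι => H) 2) :
    ∃ y' x' : lp (fun _ : ℕ => H) 2, vecFun y' x' = vecFun y x := by
  obtain ⟨e, he⟩ := exists_injective_nat ι
  have key : ∀ z : lp (fun _ : ι => H) 2, Memℓp (Function.extend e (fun i => z i) 0) 2 := by
    intro z
    rw [memℓp_two_iff, ← he.summable_iff]
    · simpa [Function.comp_def, he.extend_apply] using! summable_norm_sq z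
    · intro n hn
      rw [Function.extend_apply' _ _ _ hn]
      simp
  refine ⟨⟨_, key y⟩, ⟨_, key x⟩, ?_⟩
  ext T
  rw [vecFun_eq_tsum, vecFun_eq_tsum, ← he.tsum_eq]
  · simp [he.extend_apply]
  · intro n hn
    by_contra h
    rw [Function.mem_support] at hn
    apply hn
    change ⟪Function.extend e (fun i => y i) 0 n, _⟫_ℂ = 0
    rw [Function.extend_apply' _ _ _ h]
    simp

/-- A countable sum of vector functionals, with square summable families of vectors, is a vector
functional. -/
theorem exists_hasSum_vecFun [Countable κ] (y x : κ → lp (fun _ : ℕ => H) 2)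
    (hy : Summable fun k => ‖y k‖ ^ 2) (hx : Summable fun k => ‖x k‖ ^ 2) :
    ∃ y' x' : lp (fun _ : ℕ => H) 2, ∀ T, HasSum (fun k => vecFun (y k) (x k) T)
      (vecFun y' x' T) := by
  have key : ∀ z : κ → lp (fun _ : ℕ => H) 2, (Summable fun k => ‖z k‖ ^ 2) →
      Memℓp (fun p : κ × ℕ => z p.1 p.2) 2 := by
    intro z hz
    rw [memℓp_two_iff, summable_prod_of_nonneg (fun _ => by positivity)]
    refine ⟨fun k => summable_norm_sq (z k), ?_⟩
    simpa only [(hasSum_norm_sq _).tsum_eq] using hz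
  obtain ⟨y', x', h⟩ := exists_vecFun_nat (⟨_, key y hy⟩ : lp (fun _ : κ × ℕ => H) 2)
    ⟨_, key x hx⟩
  refine ⟨y', x', fun T => ?_⟩
  rw [h]
  exact (hasSum_vecFun _ _ T).prod_fiberwise fun k => hasSum_vecFun (y k) (x k) T

theorem continuous_vecFun [Countable ι] {σ : Type*} [SetLike σ (H →L[ℂ] H)] (S : σ)
    (y x : lp (fun _ : ι => H) 2) :
    Continuous[ultraweakOn S, inferInstance] fun s : S => vecFun y x (s : H →L[ℂ] H) := by
  obtain ⟨y', x', h⟩ := exists_vecFun_nat y x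
  rw [← h]
  have h1 : Continuous[ultraweak H, inferInstance] (vecFun y' x') := by
    refine continuous_iInf_dom (i := x') (continuous_iInf_dom (i := y') ?_)
    have : ⇑(vecFun y' x') = fun T : H →L[ℂ] H => ∑' n, ⟪y' n, T (x' n)⟫_ℂ :=
      funext fun T => vecFun_eq_tsum y' x' T
    rw [this]
    exact continuous_induced_dom
  exact @Continuous.comp _ _ _ (ultraweakOn S) (ultraweak H) _ _ _ h1 continuous_induced_dom

/-- A functional on a von Neumann algebra is weak* continuous iff it is a vector functional. -/
theorem continuous_iff_exists_vecFun (M : VonNeumannAlgebra H) (φ : M →ₗ[ℂ] ℂ) :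
    Continuous[ultraweakOn M, inferInstance] φ ↔
      ∃ y x : lp (fun _ : ℕ => H) 2, ∀ m : M, φ m = vecFun y x (m : H →L[ℂ] H) := by
  constructor
  · intro hφ
    let f : lp (fun _ : ℕ => H) 2 × lp (fun _ : ℕ => H) 2 → M →ₗ[ℂ] ℂ := fun p =>
      { toFun := fun m => vecFun p.1 p.2 (m : H →L[ℂ] H)
        map_add' := fun a b => map_add (vecFun p.1 p.2) _ _
        map_smul' := fun c a => map_smul (vecFun p.1 p.2) _ _ }
    have h1 : ultraweakOn M = ⨅ p, TopologicalSpace.induced (f p) inferInstance := by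
      refine le_antisymm (le_iInf fun p => ?_) ?_
      · exact continuous_iff_le_induced.1 (continuous_vecFun M p.1 p.2)
      · simp only [ultraweakOn, ultraweak, induced_iInf, induced_compose]
        refine le_iInf fun x => le_iInf fun y => (iInf_le _ (y, x)).trans_eq ?_
        congr 1
    -- A functional continuous for the topology induced by a family of functionals is a finite
    -- linear combination of them; finitely many vector functionals then merge into one.
    have h2 : φ ∈ Submodule.span ℂ (Set.range f) := by
      rw [LinearMap.mem_span_iff_continuous, ← h1]
      exact hφ
    obtain ⟨t, ht⟩ := Finsupp.mem_span_range_iff_exists_finsupp.1 h2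
    obtain ⟨y, x, h⟩ := exists_hasSum_vecFun (κ := t.support) (fun k => k.1.1)
      (fun k => t k.1 • k.1.2) (Summable.of_finite) (Summable.of_finite)
    refine ⟨y, x, fun m => ?_⟩
    rw [← (h m).tsum_eq, tsum_fintype, ← ht, Finsupp.sum, LinearMap.sum_apply,
      ← Finset.sum_coe_sort]
    refine Finset.sum_congr rfl fun k _ => ?_
    simp only [vecFun_apply, amp_smul_right, inner_smul_right]
    rfl
  · rintro ⟨y, x, h⟩
    rw [show ⇑φ = fun m : M => vecFun y x (m : H →L[ℂ] H) from funext h]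
    exact continuous_vecFun M y x

/-! ### Weak* compactness of balls. -/

/-- Bounded parts of a von Neumann algebra are weak* compact. -/
theorem exists_tendsto_vecFun (D : VonNeumannAlgebra H) (C : ℝ) {α : Type*} (U : Ultrafilter α)
    (F : α → H →L[ℂ] H) (hF : ∀ a, F a ∈ D ∧ ‖F a‖ ≤ C) :
    ∃ T ∈ D, ‖T‖ ≤ C ∧ ∀ y x : lp (fun _ : ι => H) 2,
      Tendsto (fun a => vecFun y x (F a)) U (𝓝 (vecFun y x T)) := by
  have hC : 0 ≤ C := (norm_nonneg _).trans (hF (U.nonempty_of_mem univ_mem).some).2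
  have hb : ∀ a v w, ‖⟪F a v, w⟫_ℂ‖ ≤ C * ‖v‖ * ‖w‖ := fun a v w =>
    (norm_inner_le_norm _ _).trans (mul_le_mul_of_nonneg_right
      ((F a).le_of_opNorm_le (hF a).2 v) (norm_nonneg _))
  have h1 : ∀ v w : H, ∃ b : ℂ, ‖b‖ ≤ C * ‖v‖ * ‖w‖ ∧
      Tendsto (fun a => ⟪F a v, w⟫_ℂ) U (𝓝 b) := by
    intro v w
    obtain ⟨b, hb1, hb2⟩ := (isCompact_closedBall (0 : ℂ) (C * ‖v‖ * ‖w‖)).ultrafilter_le_nhds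
      (U.map fun a => ⟪F a v, w⟫_ℂ) (by
        rw [le_principal_iff, Ultrafilter.mem_coe, Ultrafilter.mem_map]
        refine univ_mem' fun a => ?_
        simpa using hb a v w)
    exact ⟨b, by simpa using hb1, hb2⟩
  choose B hB hlim using h1
  -- The ultrafilter limits of the matrix entries form a bounded sesquilinear form, hence an
  -- operator `T`.
  let B' : H →L⋆[ℂ] H →L[ℂ] ℂ := LinearMap.mkContinuous₂
    (LinearMap.mk₂'ₛₗ (starRingEnd ℂ) (RingHom.id ℂ) B
      (fun v v' w => tendsto_nhds_unique (hlim (v + v') w) (by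
        simpa only [map_add, inner_add_left] using (hlim v w).add (hlim v' w)))
      (fun c v w => tendsto_nhds_unique (hlim (c • v) w) (by
        simpa only [map_smul, inner_smul_left, smul_eq_mul] using (hlim v w).const_mul _))
      (fun v w w' => tendsto_nhds_unique (hlim v (w + w')) (by
        simpa only [inner_add_right] using (hlim v w).add (hlim v w')))
      (fun c v w => tendsto_nhds_unique (hlim v (c • w)) (by
        simpa only [inner_smul_right, smul_eq_mul, RingHom.id_apply] using
          (hlim v w).const_mul _))) C hB
  let T := InnerProductSpace.continuousLinearMapOfBilin B'
  have hT : ∀ v w, ⟪T v, w⟫_ℂ = B v w := fun v w =>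
    InnerProductSpace.continuousLinearMapOfBilin_apply B' v w
  have hTC : ‖T‖ ≤ C := by
    refine T.opNorm_le_bound hC fun v => ?_
    have h2 := hB v (T v)
    rw [← hT, inner_self_eq_norm_sq_to_K] at h2
    simp only [Complex.coe_algebraMap, norm_pow, Complex.norm_real, norm_norm] at h2
    rw [sq] at h2
    rcases (norm_nonneg (T v)).eq_or_lt with h0 | h0
    · rw [← h0]; positivity
    · exact le_of_mul_le_mul_right h2 h0
  refine ⟨T, ?_, hTC, fun y x => ?_⟩
  -- Commuting with each element of the commutant passes to limits of matrix entries, so `T` lies in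
  -- the bicommutant.
  · rw [← commutant_commutant D, mem_commutant_iff]
    intro g hg
    rw [mem_commutant_iff] at hg
    ext v
    refine ext_inner_right ℂ fun w => ?_
    change ⟪g (T v), w⟫_ℂ = ⟪T (g v), w⟫_ℂ
    rw [← ContinuousLinearMap.adjoint_inner_right, hT, hT]
    refine tendsto_nhds_unique (hlim v _) ((hlim (g v) w).congr fun a => ?_)
    rw [ContinuousLinearMap.adjoint_inner_right]
    congr 1
    exact congr($(hg _ (hF a).1) v)
  · have h3 : Summable fun i => C * (‖y i‖ ^ 2 + ‖x i‖ ^ 2) :=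
      ((summable_norm_sq y).add (summable_norm_sq x)).mul_left C
    simp only [vecFun_eq_tsum]
    refine tendsto_tsum_of_dominated_convergence h3 (fun i => ?_)
      (Eventually.of_forall fun a i => ?_)
    · rw [← inner_conj_symm, hT]
      refine ((continuous_star.tendsto _).comp (hlim (x i) (y i))).congr fun a => ?_
      exact inner_conj_symm _ _
    · rw [norm_inner_symm]
      refine (hb a _ _).trans ?_
      rw [mul_assoc]
      refine mul_le_mul_of_nonneg_left ?_ hC
      nlinarith [sq_nonneg (‖y i‖ - ‖x i‖), sq_nonneg (‖y i‖), sq_nonneg ‖x i‖]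

/-! ### Functional calculus and positive functionals. -/

theorem cfc_mem (N : VonNeumannAlgebra H) {a : H →L[ℂ] H} (ha : a ∈ N) (f : ℝ → ℝ) :
    cfc f a ∈ N := by
  rw [← commutant_commutant N, mem_commutant_iff]
  intro g hg
  rw [mem_commutant_iff] at hg
  exact (Commute.cfc_real (hg a ha) f).symm

/-- An approximate polar decomposition inside a commutative von Neumann algebra. -/
theorem exists_approx_polar (N : VonNeumannAlgebra H) (hN : ∀ x ∈ N, ∀ y ∈ N, x * y = y * x)
    {e : H →L[ℂ] H} (he : e ∈ N) {δ : ℝ} (hδ : 0 < δ) :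
    ∃ s ∈ N, ∃ y ∈ N, 0 ≤ s ∧ ‖y‖ ≤ 1 ∧ e = s * y ∧
      s ≤ e * star y + algebraMap ℝ (H →L[ℂ] H) δ := by
  set p := star e * e with hp
  have hpN : p ∈ N := mul_mem (star_mem he) he
  have hp0 : 0 ≤ p := star_mul_self_nonneg e
  have hpsa : IsSelfAdjoint p := .of_nonneg hp0
  have hpos : ∀ t ∈ spectrum ℝ p, 0 ≤ t := fun t ht => spectrum_nonneg_of_nonneg hp0 ht
  have hpos' : ∀ t ∈ spectrum ℝ p, 0 < √(t + δ ^ 2) := fun t ht =>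
    Real.sqrt_pos.2 (by have := hpos t ht; positivity)
  have hc1 : ContinuousOn (fun t : ℝ => √(t + δ ^ 2)) (spectrum ℝ p) := by fun_prop
  have hc2 : ContinuousOn (fun t : ℝ => (√(t + δ ^ 2))⁻¹) (spectrum ℝ p) :=
    hc1.inv₀ fun t ht => (hpos' t ht).ne'
  -- With `p = e* e`, take `s = √(p + δ²)`, which is invertible, and `y = s⁻¹ e`; no partial
  -- isometry is needed. Since `e e* = p` by commutativity, `s - e y* = δ² s⁻¹ ≤ δ`.
  set s := cfc (fun t : ℝ => √(t + δ ^ 2)) p with hs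
  set r := cfc (fun t : ℝ => (√(t + δ ^ 2))⁻¹) p with hr
  have hsN : s ∈ N := cfc_mem N hpN _
  have hrN : r ∈ N := cfc_mem N hpN _
  have hrsa : star r = r := (cfc_predicate _ p : IsSelfAdjoint r)
  have hsr : s * r = 1 := by
    rw [hs, hr, ← cfc_mul _ _ p hc1 hc2, ← cfc_one ℝ p]
    exact cfc_congr fun t ht => mul_inv_cancel₀ (hpos' t ht).ne'
  have hpid : p = cfc (fun t : ℝ => t) p := (cfc_id' ℝ p).symm
  have hee : e * star e = p := hN _ he _ (star_mem he)
  refine ⟨s, hsN, r * e, mul_mem hrN he, cfc_nonneg fun t _ => Real.sqrt_nonneg _, ?_, ?_, ?_⟩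
  · have h1 : star (r * e) * (r * e) =
        cfc (fun t : ℝ => (√(t + δ ^ 2))⁻¹ * (√(t + δ ^ 2))⁻¹ * t) p := by
      rw [cfc_mul (fun t : ℝ => (√(t + δ ^ 2))⁻¹ * (√(t + δ ^ 2))⁻¹) (fun t => t) p (hc2.mul hc2),
        cfc_mul _ _ p hc2 hc2, ← hpid, ← hr, star_mul, hrsa, mul_assoc,
        hN (star e) (star_mem he) _ (mul_mem hrN (mul_mem hrN he)), ← hee]
      simp only [mul_assoc]
    have h2 : ‖star (r * e) * (r * e)‖ ≤ 1 := by
      rw [h1]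
      refine norm_cfc_le zero_le_one fun t ht => ?_
      have h3 := hpos t ht
      rw [← mul_inv, Real.mul_self_sqrt (by positivity), Real.norm_of_nonneg (by positivity),
        inv_mul_le_one₀ (by positivity)]
      nlinarith [sq_nonneg δ]
    rw [CStarRing.norm_star_mul_self] at h2
    nlinarith [norm_nonneg (r * e)]
  · rw [← mul_assoc, hsr, one_mul]
  · have h1 : e * star (r * e) = cfc (fun t : ℝ => t * (√(t + δ ^ 2))⁻¹) p := by
      rw [cfc_mul _ _ p (by fun_prop) hc2, ← hpid, star_mul, hrsa, ← mul_assoc, hee]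
    rw [h1, hs, ← cfc_add_const δ _ p (by exact continuousOn_id.mul hc2)]
    refine cfc_mono (fun t ht => ?_) hc1 ((continuousOn_id.mul hc2).add continuousOn_const)
    have h3 := hpos' t ht
    have h4 := hpos t ht
    have h5 := Real.sq_sqrt (show 0 ≤ t + δ ^ 2 by positivity)
    have h6 : δ ≤ √(t + δ ^ 2) := Real.le_sqrt_of_sq_le (by linarith)
    rw [← div_eq_mul_inv, ← sub_le_iff_le_add, le_div_iff₀ h3]
    nlinarith

theorem sqrt_mem (N : VonNeumannAlgebra H) {a : H →L[ℂ] H} (ha : a ∈ N) : CFC.sqrt a ∈ N := by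
  rw [CFC.sqrt_eq_cfc, ← commutant_commutant N, mem_commutant_iff]
  intro g hg
  rw [mem_commutant_iff] at hg
  exact (Commute.cfc_nnreal (hg a ha) _).symm

/-- Both `φ 1` and `φ (‖a‖ • 1 - a)` are nonnegative, hence real. -/
theorem im_map_eq_zero (N : VonNeumannAlgebra H) {φ : N →ₗ[ℂ] ℂ}
    (hφ : ∀ m : N, 0 ≤ (m : H →L[ℂ] H) → 0 ≤ φ m) {a : N} (ha : star a = a) : (φ a).im = 0 := by
  have hsa : IsSelfAdjoint (a : H →L[ℂ] H) := congr(Subtype.val $ha)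
  have h1 := hφ 1 zero_le_one
  have h2 := hφ (((‖(a : H →L[ℂ] H)‖ : ℝ) : ℂ) • 1 - a) (by
    have := sub_nonneg.2 hsa.le_algebraMap_norm_self
    simpa [Algebra.algebraMap_eq_smul_one] using! this)
  rw [map_sub, map_smul] at h2
  have h3 := (Complex.nonneg_iff.1 h1).2
  have h4 := (Complex.nonneg_iff.1 h2).2
  simp [← h3] at h4
  exact h4

theorem map_star_of_nonneg (N : VonNeumannAlgebra H) {φ : N →ₗ[ℂ] ℂ}
    (hφ : ∀ m : N, 0 ≤ (m : H →L[ℂ] H) → 0 ≤ φ m) (x : N) : φ (star x) = star (φ x) := by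
  have h1 := im_map_eq_zero N hφ (a := x + star x) (by rw [star_add, star_star, add_comm])
  have h2 := im_map_eq_zero N hφ (a := Complex.I • (x - star x)) (by
    apply Subtype.ext
    simp only [StarMemClass.coe_star, SetLike.val_smul, AddSubgroupClass.coe_sub, star_smul,
      star_sub, star_star]
    rw [Complex.star_def, Complex.conj_I, neg_smul, ← smul_neg, neg_sub])
  rw [map_add, Complex.add_im] at h1
  rw [map_smul, map_sub, smul_eq_mul, Complex.I_mul_im, Complex.sub_re] at h2
  apply Complex.ext
  · simp; linarith
  · simp; linarith

/-- Rotate `t` by a phase to `t'` with `φ (s t') = |φ (s t)|`. With `b = √s`, commutativity gives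
`2s - (s t' + (s t')*) = b (2 - t' - t'*) b ≥ 0`; apply `φ`. -/
theorem norm_map_mul_le (N : VonNeumannAlgebra H) (hN : ∀ x ∈ N, ∀ y ∈ N, x * y = y * x)
    {φ : N →ₗ[ℂ] ℂ} (hφ : ∀ m : N, 0 ≤ (m : H →L[ℂ] H) → 0 ≤ φ m) {s t : N}
    (hs : 0 ≤ (s : H →L[ℂ] H)) (ht : ‖(t : H →L[ℂ] H)‖ ≤ 1) : ‖φ (s * t)‖ ≤ (φ s).re := by
  obtain ⟨c, hc, hc'⟩ : ∃ c : ℂ, ‖c‖ = 1 ∧ (‖φ (s * t)‖ : ℂ) = c * φ (s * t) := by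
    obtain ⟨c, hc, h⟩ := RCLike.exists_norm_eq_mul_self (φ (s * t))
    exact ⟨c, hc, h⟩
  set t' := c • t with ht'
  have hnt : ‖(t' : H →L[ℂ] H)‖ ≤ 1 := by
    rw [ht', SetLike.val_smul, norm_smul, hc, one_mul]; exact ht
  have h1 : 0 ≤ (((2 : ℂ) • s - (s * t' + star (s * t')) : N) : H →L[ℂ] H) := by
    set b := CFC.sqrt (s : H →L[ℂ] H)
    have hbN : b ∈ N := sqrt_mem N s.2
    have hbb : b * b = s := CFC.sqrt_mul_sqrt_self _ hs
    have hb : IsSelfAdjoint b := .of_nonneg (CFC.sqrt_nonneg _)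
    have h2 : (((2 : ℂ) • s - (s * t' + star (s * t')) : N) : H →L[ℂ] H)
        = b * ((2 : ℂ) • 1 - ((t' : H →L[ℂ] H) + star (t' : H →L[ℂ] H))) * b := by
      have hss : star (s : H →L[ℂ] H) = s := (IsSelfAdjoint.of_nonneg hs)
      simp only [AddSubgroupClass.coe_sub, SetLike.val_smul, AddMemClass.coe_add,
        MulMemClass.coe_mul, StarMemClass.coe_star, star_mul, hss, mul_sub, sub_mul, mul_add, add_mul,
        mul_smul_comm,
        smul_mul_assoc, mul_one]
      rw [hbb, mul_assoc, hN _ t'.2 b hbN, ← mul_assoc, hbb, mul_assoc b (star _),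
        hN (star _) (star_mem t'.2) b hbN, ← mul_assoc b b, hbb, hN (star _) (star_mem t'.2) _ s.2]
    rw [h2]
    refine hb.conjugate_nonneg (sub_nonneg.2 ?_)
    have h3 : IsSelfAdjoint ((t' : H →L[ℂ] H) + star (t' : H →L[ℂ] H)) := .add_star_self _
    refine h3.le_algebraMap_norm_self.trans ?_
    have h4 : ‖(t' : H →L[ℂ] H) + star (t' : H →L[ℂ] H)‖ ≤ 2 := by
      refine (norm_add_le _ _).trans ?_
      rw [norm_star]; linarith
    have h5 : (2 : ℂ) • (1 : H →L[ℂ] H) = algebraMap ℝ (H →L[ℂ] H) 2 := by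
      rw [Algebra.algebraMap_eq_smul_one, ← Complex.coe_smul]; simp
    rw [h5]
    exact algebraMap_mono _ h4
  have h2 := (Complex.nonneg_iff.1 (hφ _ h1)).1
  rw [map_sub, map_add, map_star_of_nonneg N hφ, map_smul, ht', mul_smul_comm, map_smul,
    smul_eq_mul, smul_eq_mul, ← hc'] at h2
  simp at h2
  linarith

/-! ### Radon–Nikodym derivatives and positive normal functionals. -/

/-- A Radon–Nikodym theorem for commutative von Neumann algebras. -/
theorem exists_radon_nikodym (N : VonNeumannAlgebra H) (hN : ∀ x ∈ N, ∀ y ∈ N, x * y = y * x)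
    (y x : lp (fun _ : ι => H) 2) {C : ℝ} (hC : 0 ≤ C)
    (hpos : ∀ s ∈ N, 0 ≤ s → 0 ≤ vecFun y x s) (φ : N →ₗ[ℂ] ℂ)
    (hφ : ∀ s t : N, 0 ≤ (s : H →L[ℂ] H) → ‖(t : H →L[ℂ] H)‖ ≤ 1 →
      ‖φ (s * t)‖ ≤ C * (vecFun y x s).re) :
    ∃ h : N, ‖(h : H →L[ℂ] H)‖ ≤ C ∧ ∀ d : N, φ d = vecFun y x (d * h) := by
  -- `WeakBilin B` is the algebraic dual of `N` with pointwise convergence; its continuous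
  -- functionals are evaluations at elements of `N`. The functionals `vecFun y x (· h)` with `‖h‖ ≤
  -- C` form a compact convex set there, and `φ` is shown to belong to it by separation.
  let B : (N →ₗ[ℂ] ℂ) →ₗ[ℂ] N →ₗ[ℂ] ℂ := LinearMap.id
  have hB : Function.Injective B := fun _ _ h => h
  have hvec : ∀ (d : N) (h : H →L[ℂ] H),
      vecFun y x (d * h) = vecFun (amp (star (d : H →L[ℂ] H)) y) x h := by
    intro d h
    rw [vecFun_apply, vecFun_apply, inner_amp_left, star_star, amp_mul]
  let g : (H →L[ℂ] H) → WeakBilin B := fun h =>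
    ({ toFun := fun d => vecFun y x (d * h)
       map_add' := fun a b => by simp [add_mul]
       map_smul' := fun c a => by simp } : N →ₗ[ℂ] ℂ)
  have hg : ∀ h (d : N), B (g h) d = vecFun y x (d * h) := fun _ _ => rfl
  let K₀ : Set (H →L[ℂ] H) := {h | h ∈ N ∧ ‖h‖ ≤ C}
  have hcomp : IsCompact (g '' K₀) := by
    rw [isCompact_iff_ultrafilter_le_nhds']
    intro U hU
    -- A preimage in `K₀` is chosen for every `w`, with the dummy value `0` off the image, so that
    -- the compactness lemma applies to a total function.
    have hsec : ∀ w : WeakBilin B, ∃ h ∈ K₀, w ∈ g '' K₀ → g h = w := by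
      intro w
      by_cases hw : w ∈ g '' K₀
      · obtain ⟨h, hh, e⟩ := hw
        exact ⟨h, hh, fun _ => e⟩
      · exact ⟨0, ⟨zero_mem N, by simpa using hC⟩, fun h => absurd h hw⟩
    choose F hF hF' using hsec
    obtain ⟨T, hTN, hTC, hT⟩ := exists_tendsto_vecFun (ι := ι) N C U F hF
    refine ⟨g T, ⟨T, ⟨hTN, hTC⟩, rfl⟩, ?_⟩
    change Tendsto id (U : Filter (WeakBilin B)) (𝓝 (g T))
    rw [WeakBilin.tendsto_iff_forall_eval_tendsto B hB]
    intro d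
    have h1 := hT (amp (star (d : H →L[ℂ] H)) y) x
    rw [← hvec] at h1
    refine h1.congr' ?_
    filter_upwards [hU] with w hw
    rw [← hvec, ← hg, hF' w hw]
    rfl
  have hconv : Convex ℝ (g '' K₀) := by
    rintro _ ⟨h, hh, rfl⟩ _ ⟨k, hk, rfl⟩ a b ha hb hab
    refine ⟨(a : ℂ) • h + (b : ℂ) • k, ⟨add_mem (SMulMemClass.smul_mem _ hh.1)
      (SMulMemClass.smul_mem _ hk.1), ?_⟩, ?_⟩
    · refine (norm_add_le _ _).trans ?_
      rw [norm_smul, norm_smul, Complex.norm_of_nonneg ha, Complex.norm_of_nonneg hb]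
      have := mul_le_mul_of_nonneg_left hh.2 ha
      have := mul_le_mul_of_nonneg_left hk.2 hb
      nlinarith
    · refine LinearMap.ext fun d => ?_
      change vecFun y x _ = a • vecFun y x _ + b • vecFun y x _
      simp [mul_add]
  have ht2 : T2Space (WeakBilin B) := (WeakBilin.isEmbedding hB).t2Space
  by_cases hmem : (φ : WeakBilin B) ∈ g '' K₀
  · obtain ⟨h, hh, e⟩ := hmem
    exact ⟨⟨h, hh.1⟩, hh.2, fun d => by rw [← hg, e]; rfl⟩
  exfalso
  obtain ⟨f, u, hf1, hf2⟩ := RCLike.geometric_hahn_banach_closed_point (𝕜 := ℂ) hconv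
    hcomp.isClosed hmem
  obtain ⟨d, hd⟩ := LinearMap.dualEmbedding_surjective B f
  have hd' : ∀ w : WeakBilin B, f w = B w d := fun w => by rw [← hd]; rfl
  -- Write `d = s t` approximately polarly and test the separation at `h = C t*`. With `τ = vecFun y
  -- x`, this gives `Re φ(d) ≤ C τ(s) ≤ C Re τ(d t*) + C δ τ(1) < u + C δ τ(1)`.
  have h1 : ∀ δ : ℝ, 0 < δ → (φ d).re < u + C * (δ * (vecFun y x 1).re) := by
    intro δ hδ
    obtain ⟨s, hs, t, ht, hs0, ht1, hst, hle⟩ := exists_approx_polar N hN d.2 hδ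
    have h2 := hf1 _ ⟨(C : ℂ) • star t, ⟨SMulMemClass.smul_mem _ (star_mem ht), by
      rw [norm_smul, norm_star, Complex.norm_of_nonneg hC]
      exact mul_le_of_le_one_right hC ht1⟩, rfl⟩
    rw [hd', hg, mul_smul_comm, map_smul] at h2
    have h3 := (Complex.nonneg_iff.1 (hpos _ (sub_mem (add_mem (mul_mem d.2 (star_mem ht)) (by
      rw [Algebra.algebraMap_eq_smul_one, ← Complex.coe_smul]
      exact SMulMemClass.smul_mem _ (one_mem N))) hs) (sub_nonneg.2 hle))).1
    rw [map_sub, map_add, Algebra.algebraMap_eq_smul_one, ← Complex.coe_smul, map_smul] at h3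
    have h4 := hφ ⟨s, hs⟩ ⟨t, ht⟩ hs0 ht1
    have h5 : d = ⟨s, hs⟩ * ⟨t, ht⟩ := Subtype.ext hst
    rw [← h5] at h4
    have h6 := (Complex.re_le_norm _).trans h4
    simp at h2 h3 h6
    nlinarith
  have h2 : u < (φ d).re := hd' φ ▸ hf2
  have h3 : 0 ≤ (vecFun y x 1).re := (Complex.nonneg_iff.1 (hpos 1 (one_mem N) zero_le_one)).1
  -- This `δ` makes the error `C δ τ(1)` smaller than the gap `Re φ(d) - u`.
  have h4 := h1 (((φ d).re - u) / (C * (vecFun y x 1).re + 1)) (by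
    have : 0 ≤ C * (vecFun y x 1).re := by positivity
    exact div_pos (by linarith) (by linarith))
  have h5 : 0 < C * (vecFun y x 1).re + 1 := by positivity
  rw [mul_comm (_ / _), ← mul_assoc, mul_div_assoc', ← sub_lt_iff_lt_add', lt_div_iff₀ h5] at h4
  nlinarith

theorem vecFun_amp_left (T S : H →L[ℂ] H) (y x : lp (fun _ : ι => H) 2) :
    vecFun (amp S y) x T = vecFun y x (star S * T) := by
  rw [vecFun_apply, vecFun_apply, inner_amp_left, amp_mul]

theorem vecFun_amp_right (T S : H →L[ℂ] H) (y x : lp (fun _ : ι => H) 2) :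
    vecFun y (amp S x) T = vecFun y x (T * S) := by
  rw [vecFun_apply, vecFun_apply, amp_mul]

/-- A positive vector functional on a commutative von Neumann algebra is given by a single vector of
`ℓ²(H)`. -/
theorem exists_vecFun_self (M : VonNeumannAlgebra H) (hM : ∀ x ∈ M, ∀ y ∈ M, x * y = y * x)
    {ψ : M →ₗ[ℂ] ℂ} (hψ : ∀ m : M, 0 ≤ (m : H →L[ℂ] H) → 0 ≤ ψ m) (y x : lp (fun _ : ι => H) 2)
    (h : ∀ m : M, ψ m = vecFun y x (m : H →L[ℂ] H)) :
    ∃ z : lp (fun _ : ι => H) 2, ∀ m : M, ψ m = vecFun z z (m : H →L[ℂ] H) := by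
  set w : lp (fun _ : ι => H) 2 := (2⁻¹ : ℂ) • (x + y) with hw
  -- Polarization: `4 Re ⟨y, s x⟩ = ⟨x + y, s (x + y)⟩ - ⟨x - y, s (x - y)⟩`, and the last term is
  -- nonnegative.
  have hle : ∀ s : M, 0 ≤ (s : H →L[ℂ] H) → (ψ s).re ≤ (vecFun w w (s : H →L[ℂ] H)).re := by
    intro s hs
    have h1 := (Complex.nonneg_iff.1 (vecFun_nonneg (x - y) hs)).1
    have h2 := vecFun_star y x (s : H →L[ℂ] H)
    rw [(IsSelfAdjoint.of_nonneg hs).star_eq] at h2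
    have h3 : (vecFun y x (s : H →L[ℂ] H)).re = (vecFun x y (s : H →L[ℂ] H)).re := by
      rw [h2]; exact Complex.conj_re _
    rw [h]
    simp only [vecFun_apply] at h3
    simp only [hw, vecFun_apply, amp_sub_right, amp_add_right, amp_smul_right, inner_add_left,
      inner_add_right, inner_sub_left, inner_sub_right, inner_smul_left, inner_smul_right] at h1 ⊢
    simp [-inner_self_eq_norm_sq_to_K] at h1 ⊢
    linarith
  obtain ⟨k₀, -, hk₀⟩ := exists_radon_nikodym M hM w w zero_le_one
    (fun s _ hs => vecFun_nonneg w hs) ψ fun s t hs ht =>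
      (norm_map_mul_le M hM hψ hs ht).trans (by rw [one_mul]; exact hle s hs)
  set k : H →L[ℂ] H := (2⁻¹ : ℂ) • ((k₀ : H →L[ℂ] H) + star (k₀ : H →L[ℂ] H)) with hk
  have hkM : k ∈ M := SMulMemClass.smul_mem _ (add_mem k₀.2 (star_mem k₀.2))
  have hksa : IsSelfAdjoint k := by
    rw [IsSelfAdjoint, hk, star_smul, star_add, star_star, add_comm]
    simp
  have hψk : ∀ m : M, vecFun w w (m * k) = ψ m := by
    intro m
    have h1 : vecFun w w (m * star (k₀ : H →L[ℂ] H)) = ψ m := by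
      have h2 := hk₀ (star m)
      rw [map_star_of_nonneg M hψ, StarMemClass.coe_star, hM _ (star_mem m.2) _ k₀.2] at h2
      rw [← star_inj, h2, ← vecFun_star, star_mul, star_star]
    rw [hk, mul_smul_comm, mul_add, map_smul, map_add, h1, ← hk₀, smul_eq_mul]
    ring
  set kn := cfc (fun t : ℝ => max (-t) 0) k with hkn
  set kp := cfc (fun t : ℝ => max t 0) k with hkp
  have hknM : kn ∈ M := cfc_mem M hkM _
  have hkpM : kp ∈ M := cfc_mem M hkM _
  have hkn0 : 0 ≤ kn := cfc_nonneg fun t _ => le_max_right _ _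
  have hkp0 : 0 ≤ kp := cfc_nonneg fun t _ => le_max_right _ _
  have hid : cfc (fun t : ℝ => t) k = k := cfc_id' ℝ k
  have hsum : kp = k + kn := by
    rw [hkn]
    nth_rw 1 [← hid]
    rw [← cfc_add k (fun t : ℝ => t) (fun t : ℝ => max (-t) 0)]
    refine cfc_congr fun t _ => ?_
    rcases le_total t 0 with ht | ht
    · simp [ht]
    · simp [ht]
  have hmul : kn * k = -(star kn * kn) := by
    rw [(IsSelfAdjoint.of_nonneg hkn0).star_eq, hkn]
    nth_rw 2 [← hid]
    rw [← cfc_mul _ _ k, ← cfc_mul _ _ k, ← cfc_neg]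
    refine cfc_congr fun t _ => ?_
    rcases le_total t 0 with ht | ht
    · simp [ht]
    · simp [ht]
  -- Positivity of `ψ` at the negative part `kn` of the density gives `0 ≤ ψ(kn) = -‖kn w‖²`. Hence
  -- `k` may be replaced by its positive part `kp`, whose square root is moved onto `w`.
  have hknw : amp kn w = 0 := by
    have h1 := hψ ⟨kn, hknM⟩ hkn0
    rw [← hψk, hmul, map_neg, vecFun_star_mul_self] at h1
    have h2 := (Complex.nonneg_iff.1 h1).1
    rw [← Complex.ofReal_pow, ← Complex.ofReal_neg, Complex.ofReal_re] at h2
    have h3 : ‖amp kn w‖ ^ 2 = 0 := le_antisymm (by linarith) (sq_nonneg _)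
    simpa using h3
  refine ⟨amp (CFC.sqrt kp) w, fun m => ?_⟩
  have hb := sqrt_mem M hkpM
  rw [vecFun_amp_left, vecFun_amp_right, (IsSelfAdjoint.of_nonneg (CFC.sqrt_nonneg kp)).star_eq,
    hM _ hb _ m.2, mul_assoc, CFC.sqrt_mul_sqrt_self _ hkp0, hsum, mul_add, map_add, hψk,
    ← vecFun_amp_right, hknw, vecFun_apply]
  have : amp (m : H →L[ℂ] H) (0 : lp (fun _ : ι => H) 2) = 0 := by ext i; simp
  simp [this]

/-! ### Density in the predual and the normal expectation. -/

/-- If a vector functional `τ` on a commutative von Neumann algebra `D` is faithful, the functionals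
`τ(e ·)` with `e ∈ D` are norm dense among the vector functionals on `D`. -/
theorem exists_norm_vecFun_sub_le (D : VonNeumannAlgebra H) (y x v u : lp (fun _ : ι => H) 2)
    (hτ : ∀ e ∈ D, (∀ d ∈ D, vecFun y x (d * e) = 0) → e = 0) {ε : ℝ} (hε : 0 < ε) :
    ∃ e ∈ D, ∀ d ∈ D, ‖vecFun v u d - vecFun y x (e * d)‖ ≤ ε * ‖d‖ := by
  -- Otherwise there are contractions `F t`, annihilated by `τ(d ·)` for `d ∈ t`, on which `vecFun v
  -- u` stays above `ε`. A weak* cluster point `T` has `τ(d T) = 0` for all `d`, so `T = 0`, a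
  -- contradiction.
  have hfin : ∃ t : Finset D, ∀ a ∈ D, ‖a‖ ≤ 1 → (∀ d ∈ t, vecFun y x (d * a) = 0) →
      ‖vecFun v u a‖ ≤ ε := by
    by_contra! hcon
    choose F hFD hF1 hF0 hFε using hcon
    obtain ⟨T, hTD, -, hT⟩ := exists_tendsto_vecFun (ι := ι) D 1 (Ultrafilter.of atTop) F
      fun t => ⟨hFD t, hF1 t⟩
    have hT0 : T = 0 := by
      refine hτ T hTD fun d hd => ?_
      have h1 := hT (amp (star d) y) x
      simp only [vecFun_amp_left, star_star] at h1
      refine tendsto_nhds_unique h1 (tendsto_const_nhds.congr' ?_)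
      filter_upwards [Ultrafilter.of_le atTop (eventually_ge_atTop {(⟨d, hd⟩ : D)})] with t ht
      exact (hF0 t ⟨d, hd⟩ (ht (Finset.mem_singleton_self _))).symm
    have h1 := (hT v u).norm
    rw [hT0, map_zero, norm_zero] at h1
    exact absurd (ge_of_tendsto' h1 fun t => (hFε t).le) (not_le.2 hε)
  obtain ⟨t, ht⟩ := hfin
  let p : Submodule ℂ (H →L[ℂ] H) :=
    { carrier := {a | a ∈ D ∧ ∀ d ∈ t, vecFun y x (d * a) = 0}
      add_mem' := fun ha hb => ⟨add_mem ha.1 hb.1, fun d hd => by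
        rw [mul_add, map_add, ha.2 d hd, hb.2 d hd, add_zero]⟩
      zero_mem' := ⟨zero_mem D, fun d _ => by simp⟩
      smul_mem' := fun c a ha => ⟨SMulMemClass.smul_mem c ha.1, fun d hd => by
        rw [mul_smul_comm, map_smul, ha.2 d hd, smul_zero]⟩ }
  let f : p →L[ℂ] ℂ := (vecFun v u).comp p.subtypeL
  have hf : ‖f‖ ≤ ε := by
    refine f.opNorm_le_bound hε.le fun a => ?_
    rcases eq_or_ne (‖a‖) 0 with h0 | h0
    · rw [norm_eq_zero.1 h0]; simp
    · have h1 := ((‖a‖ : ℂ)⁻¹ • a).2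
      have h2 := ht _ h1.1 (by
        change ‖((‖a‖ : ℂ)⁻¹ • (a : H →L[ℂ] H))‖ ≤ 1
        rw [norm_smul]
        simp only [norm_inv, Complex.norm_real, norm_norm]
        exact (inv_mul_cancel₀ h0).le) h1.2
      change ‖vecFun v u ((‖a‖ : ℂ)⁻¹ • (a : H →L[ℂ] H))‖ ≤ ε at h2
      rw [map_smul, norm_smul] at h2
      simp only [norm_inv, Complex.norm_real, norm_norm] at h2
      rwa [inv_mul_le_iff₀ (by positivity), mul_comm] at h2
  -- Hahn–Banach: `vecFun v u - g` vanishes on the common kernel in `D` of finitely many `τ(d ·)`,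
  -- so on `D` it is a combination of them, while `‖g‖ ≤ ε`.
  obtain ⟨g, hg, hgn⟩ := exists_extension_norm_eq p f
  let L : t → D →ₗ[ℂ] ℂ := fun d =>
    { toFun := fun a => vecFun y x (d * a)
      map_add' := fun a b => by simp [mul_add]
      map_smul' := fun c a => by simp }
  let K : D →ₗ[ℂ] ℂ :=
    { toFun := fun a => (vecFun v u - g) (a : H →L[ℂ] H)
      map_add' := fun a b => map_add (vecFun v u - g) _ _
      map_smul' := fun c a => map_smul (vecFun v u - g) _ _ }
  have hK : K ∈ Submodule.span ℂ (Set.range L) := by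
    refine mem_span_of_iInf_ker_le_ker fun a ha => ?_
    simp only [Submodule.mem_iInf, LinearMap.mem_ker] at ha
    have h1 : (a : H →L[ℂ] H) ∈ p := ⟨a.2, fun d hd => ha ⟨d, hd⟩⟩
    change vecFun v u a - g a = 0
    rw [sub_eq_zero]
    exact (hg ⟨a, h1⟩).symm
  obtain ⟨c, hc⟩ := (Submodule.mem_span_range_iff_exists_fun ℂ).1 hK
  refine ⟨∑ i, c i • ((i : D) : H →L[ℂ] H), sum_mem fun i _ => SMulMemClass.smul_mem _ i.1.2,
    fun d hd => ?_⟩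
  have h1 : vecFun y x ((∑ i, c i • ((i : D) : H →L[ℂ] H)) * d) = vecFun v u d - g d := by
    have h2 := congr($hc ⟨d, hd⟩)
    change _ = vecFun v u d - g d at h2
    rw [← h2, Finset.sum_mul, map_sum, LinearMap.sum_apply]
    refine Finset.sum_congr rfl fun i _ => ?_
    rw [smul_mul_assoc, map_smul]
    rfl
  rw [h1, sub_sub_cancel]
  exact g.le_of_opNorm_le (hgn ▸ hf) d

theorem norm_map_mul_le_norm_mul (N : VonNeumannAlgebra H) (hN : ∀ x ∈ N, ∀ y ∈ N, x * y = y * x)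
    {φ : N →ₗ[ℂ] ℂ} (hφ : ∀ m : N, 0 ≤ (m : H →L[ℂ] H) → 0 ≤ φ m) {s : N}
    (hs : 0 ≤ (s : H →L[ℂ] H)) (t : N) : ‖φ (s * t)‖ ≤ ‖(t : H →L[ℂ] H)‖ * (φ s).re := by
  rcases eq_or_ne (t : H →L[ℂ] H) 0 with h0 | h0
  · rw [show t = 0 from Subtype.ext h0]; simp
  · have hn := norm_pos_iff.2 h0
    have h1 := norm_map_mul_le N hN hφ hs (t := ((‖(t : H →L[ℂ] H)‖ : ℂ))⁻¹ • t) (by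
      rw [SetLike.val_smul, norm_smul, norm_inv, Complex.norm_real, norm_norm,
        inv_mul_cancel₀ hn.ne'])
    rwa [mul_smul_comm, map_smul, norm_smul, norm_inv, Complex.norm_real, norm_norm,
      inv_mul_le_iff₀ hn] at h1

/-- With `norm_sub_le_of_nonneg`, this yields positivity of `E` from its being unital, contractive
and self-adjointness preserving. -/
theorem nonneg_of_norm_sub_le {a : H →L[ℂ] H} (ha : IsSelfAdjoint a) {c : ℝ}
    (h : ‖(c : ℂ) • 1 - a‖ ≤ c) : 0 ≤ a := by
  have hc : (c : ℂ) • (1 : H →L[ℂ] H) = algebraMap ℝ (H →L[ℂ] H) c := by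
    rw [Algebra.algebraMap_eq_smul_one, ← Complex.coe_smul]
  rw [hc] at h
  have h1 : IsSelfAdjoint (algebraMap ℝ (H →L[ℂ] H) c - a) :=
    (IsSelfAdjoint.algebraMap _ (.all c)).sub ha
  have h2 := h1.le_algebraMap_norm_self.trans (algebraMap_mono _ h)
  simpa using h2

theorem norm_sub_le_of_nonneg {a : H →L[ℂ] H} (ha : 0 ≤ a) : ‖((‖a‖ : ℝ) : ℂ) • 1 - a‖ ≤ ‖a‖ := by
  have hc : ((‖a‖ : ℝ) : ℂ) • (1 : H →L[ℂ] H) = algebraMap ℝ (H →L[ℂ] H) ‖a‖ := by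
    rw [Algebra.algebraMap_eq_smul_one, ← Complex.coe_smul]
  rw [hc, CStarAlgebra.norm_le_iff_le_algebraMap _ (norm_nonneg _)
    (sub_nonneg.2 (IsSelfAdjoint.of_nonneg ha).le_algebraMap_norm_self)]
  simpa using ha

/-- If `ψ` is a positive functional on `M` given by `z`, `τ` its restriction to `D`, and `τ` is
faithful on `D`, then a map `E : M → D` with `ψ (d m) = τ (d (E m))` is normal. -/
theorem exists_vecFun_comp (M D : VonNeumannAlgebra H) (hM : ∀ x ∈ M, ∀ y ∈ M, x * y = y * x)
    (hDM : D ≤ M) (z : lp (fun _ : ℕ => H) 2)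
    (hz : ∀ e ∈ D, (∀ d ∈ D, vecFun z z (d * e) = 0) → e = 0) (E : M → D)
    (hE : ∀ (d : D) (m : M), vecFun z z (d * m) = vecFun z z (d * E m))
    (v u : lp (fun _ : ℕ => H) 2) :
    ∃ y₁ x₁ y₂ x₂ : lp (fun _ : ℕ => H) 2, ∀ m : M, vecFun v u (E m) =
      vecFun y₁ x₁ (m : H →L[ℂ] H) + vecFun y₂ x₂ (m : H →L[ℂ] H) := by
  have hDc : ∀ x ∈ D, ∀ y ∈ D, x * y = y * x := fun x hx y hy => hM x (hDM hx) y (hDM hy)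
  choose c hcD hc using fun k : ℕ => exists_norm_vecFun_sub_le D z z v u hz
    (pow_pos (by norm_num : (0 : ℝ) < 1 / 2) k)
  -- The increments `c (k + 1) - c k = s k * t k` are split so that, with `b k = √(s k)`, `ψ((c (k +
  -- 1) - c k) m) = ⟨b k z, m (t k) (b k) z⟩`, where `ψ = vecFun z z`.
  choose s hs t ht hs0 ht1 hst hle using fun k : ℕ => exists_approx_polar D hDc
    (sub_mem (hcD (k + 1)) (hcD k)) (pow_pos (by norm_num : (0 : ℝ) < 1 / 2) k)
  set b : ℕ → H →L[ℂ] H := fun k => CFC.sqrt (s k) with hbdef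
  have hbD : ∀ k, b k ∈ D := fun k => sqrt_mem D (hs k)
  have hb : ∀ k, star (b k) = b k := fun k => IsSelfAdjoint.of_nonneg (CFC.sqrt_nonneg _)
  have hbb : ∀ k, b k * b k = s k := fun k => CFC.sqrt_mul_sqrt_self _ (hs0 k)
  have hY : ∀ k, ‖amp (b k) z‖ ^ 2 = (vecFun z z (s k)).re := by
    intro k
    have h1 := vecFun_star_mul_self z (b k)
    rw [hb, hbb] at h1
    rw [h1, ← Complex.ofReal_pow, Complex.ofReal_re]
  -- Evaluating `s k ≤ (c (k + 1) - c k) (t k)* + 2⁻ᵏ` bounds it by the two approximation errors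
  -- `2⁻ᵏ` and `2⁻ᵏ⁻¹` plus `2⁻ᵏ ψ(1)`. This makes the vectors `b k z` square summable.
  have hbound : ∀ k, (vecFun z z (s k)).re ≤ (2 + (vecFun z z 1).re) * (1 / 2 : ℝ) ^ k := by
    intro k
    have h1 := (Complex.nonneg_iff.1 (vecFun_nonneg z (sub_nonneg.2 (hle k)))).1
    rw [map_sub, map_add, Algebra.algebraMap_eq_smul_one, ← Complex.coe_smul, map_smul, sub_mul,
      map_sub] at h1
    have h2 := hc k _ (star_mem (ht k))
    have h3 := hc (k + 1) _ (star_mem (ht k))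
    rw [norm_star] at h2 h3
    have h4 : (vecFun z z (c (k + 1) * star (t k))).re - (vecFun z z (c k * star (t k))).re ≤
        ‖vecFun v u (star (t k)) - vecFun z z (c k * star (t k))‖ +
        ‖vecFun v u (star (t k)) - vecFun z z (c (k + 1) * star (t k))‖ := by
      rw [← Complex.sub_re]
      refine (Complex.re_le_norm _).trans ((norm_sub_le _ _).trans_eq' ?_)
      congr 1
      ring
    have h5 : (0 : ℝ) < (1 / 2) ^ k := by positivity
    have h6 := mul_le_mul_of_nonneg_left (ht1 k) h5.le
    rw [pow_succ] at h3
    simp only [smul_eq_mul, Complex.sub_re, Complex.add_re, Complex.re_ofReal_mul] at h1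
    nlinarith
  have hYs : Summable fun k => ‖amp (b k) z‖ ^ 2 := by
    refine .of_nonneg_of_le (fun _ => sq_nonneg _) (fun k => (hY k).trans_le (hbound k)) ?_
    exact (summable_geometric_of_lt_one (by norm_num) (by norm_num)).mul_left _
  have hXs : Summable fun k => ‖amp (t k) (amp (b k) z)‖ ^ 2 := by
    refine .of_nonneg_of_le (fun _ => sq_nonneg _) (fun k => ?_) hYs
    refine pow_le_pow_left₀ (norm_nonneg _) ((norm_amp_le _ _).trans ?_) 2
    exact mul_le_of_le_one_left (norm_nonneg _) (ht1 k)
  obtain ⟨y', x', hsum⟩ := exists_hasSum_vecFun _ _ hYs hXs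
  refine ⟨amp (star (c 0)) z, z, y', x', fun m => ?_⟩
  have hterm : ∀ k, vecFun (amp (b k) z) (amp (t k) (amp (b k) z)) (m : H →L[ℂ] H) =
      vecFun z z (c (k + 1) * E m) - vecFun z z (c k * E m) := by
    intro k
    have hbM := hDM (hbD k)
    rw [← amp_mul, vecFun_amp_left, vecFun_amp_right, hb, ← map_sub, ← sub_mul]
    rw [← hE ⟨_, sub_mem (hcD (k + 1)) (hcD k)⟩ m]
    congr 1
    change _ = (c (k + 1) - c k) * (m : H →L[ℂ] H)
    rw [hst k, ← hbb, mul_assoc (b k) (m : H →L[ℂ] H), hM _ m.2 _ (mul_mem (hDM (ht k)) hbM),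
      hDc _ (ht k) _ (hbD k)]
    simp only [mul_assoc]
  -- The series telescopes; the leftover initial term `c 0` accounts for the first of the two vector
  -- functionals.
  have h1 := (hsum m).tendsto_sum_nat
  simp only [hterm, Finset.sum_range_sub (fun k => vecFun z z (c k * E m))] at h1
  have h2 : Tendsto (fun k => vecFun z z (c k * E m)) atTop (𝓝 (vecFun v u (E m))) := by
    rw [tendsto_iff_norm_sub_tendsto_zero]
    refine squeeze_zero (fun _ => norm_nonneg _) (fun k => ?_)
      (g := fun k => (1 / 2 : ℝ) ^ k * ‖(E m : H →L[ℂ] H)‖) ?_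
    · rw [norm_sub_rev]
      exact hc k _ (E m).2
    · rw [← zero_mul ‖(E m : H →L[ℂ] H)‖]
      exact (tendsto_pow_atTop_nhds_zero_of_lt_one (by norm_num) (by norm_num)).mul_const _
  have h3 := tendsto_nhds_unique h1 (h2.sub_const _)
  rw [h3, vecFun_amp_left, star_star, hE ⟨c 0, hcD 0⟩ m]
  ring

/-- Existence of the normal conditional expectation that preserves a given normal state, faithful on
the subalgebra. -/
theorem exists_normalCondExp (M D : VonNeumannAlgebra H) (hM : ∀ x ∈ M, ∀ y ∈ M, x * y = y * x)
    (hDM : D ≤ M) {ψ : M →ₗ[ℂ] ℂ} (hψ : IsNormalState M ψ)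
    (hfaith : ∀ d : D, 0 ≤ (d : H →L[ℂ] H) → ψ ⟨d, hDM d.2⟩ = 0 → d = 0) :
    ∃ E : M →ₗ[ℂ] D, IsNormalCondExp M D hDM E ∧
      ∀ (m : M) (e : D), (∀ d : D, ψ (⟨d, hDM d.2⟩ * m) = ψ ⟨d * e, hDM (d * e).2⟩) → E m = e := by
  have hDc : ∀ x ∈ D, ∀ y ∈ D, x * y = y * x := fun x hx y hy => hM x (hDM hx) y (hDM hy)
  obtain ⟨y, x, hyx⟩ := (continuous_iff_exists_vecFun M ψ).1 hψ.continuous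
  obtain ⟨z, hz⟩ := exists_vecFun_self M hM hψ.map_nonneg y x hyx
  have hz0 : ∀ e ∈ D, (∀ d ∈ D, vecFun z z (d * e) = 0) → e = 0 := by
    intro e he h
    have h1 := hfaith ⟨star e * e, mul_mem (star_mem he) he⟩ (star_mul_self_nonneg e) (by
      rw [hz]; exact h _ (star_mem he))
    exact CStarRing.star_mul_self_eq_zero_iff e |>.1 congr(Subtype.val $h1)
  have huniq : ∀ e e' : D, (∀ d ∈ D, vecFun z z (d * e) = vecFun z z (d * e')) → e = e' := by
    intro e e' h
    refine Subtype.ext (sub_eq_zero.1 (hz0 _ (sub_mem e.2 e'.2) fun d hd => ?_))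
    rw [mul_sub, map_sub, h d hd, sub_self]
  have hex : ∀ m : M, ∃ e : D, ‖(e : H →L[ℂ] H)‖ ≤ ‖(m : H →L[ℂ] H)‖ ∧
      ∀ d : D, vecFun z z (d * m) = vecFun z z (d * e) := by
    intro m
    let φ : D →ₗ[ℂ] ℂ :=
      { toFun := fun d => vecFun z z (d * m)
        map_add' := fun a b => by simp [add_mul]
        map_smul' := fun c a => by simp }
    refine exists_radon_nikodym D hDc z z (norm_nonneg (m : H →L[ℂ] H))
      (fun s _ hs => vecFun_nonneg z hs) φ fun s t hs ht => ?_
    -- The domination is proved in `M`, with `t m` as the bounded factor.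
    have h1 := norm_map_mul_le_norm_mul M hM hψ.map_nonneg (s := ⟨s, hDM s.2⟩) hs (⟨t, hDM t.2⟩ * m)
    rw [hz, hz, ← mul_assoc] at h1
    refine h1.trans (mul_le_mul_of_nonneg_right ?_ ?_)
    · exact (norm_mul_le _ _).trans (mul_le_of_le_one_left (norm_nonneg _) ht)
    · exact (Complex.nonneg_iff.1 (vecFun_nonneg z hs)).1
  choose E hEn hE using hex
  have hEu : ∀ (m : M) (e : D), (∀ d ∈ D, vecFun z z (d * m) = vecFun z z (d * e)) → E m = e :=
    fun m e h => huniq _ _ fun d hd => by rw [← hE m ⟨d, hd⟩, h d hd]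
  let E' : M →ₗ[ℂ] D :=
    { toFun := E
      map_add' := fun a b => hEu _ _ fun d hd => by
        have ha := hE a ⟨d, hd⟩
        have hb := hE b ⟨d, hd⟩
        simp only [AddMemClass.coe_add, mul_add, map_add] at ha hb ⊢
        rw [ha, hb]
      map_smul' := fun c a => hEu _ _ fun d hd => by
        have ha := hE a ⟨d, hd⟩
        simp only [SetLike.val_smul, mul_smul_comm, map_smul, RingHom.id_apply] at ha ⊢
        rw [ha] }
  have hcoe : ∀ d : D, E ⟨d, hDM d.2⟩ = d := fun d => hEu _ _ fun _ _ => rfl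
  refine ⟨E', ⟨hcoe, fun m hm => ?_, hEn, fun d₁ d₂ m => ?_, ?_⟩, fun m e h => ?_⟩
  · have hsa : star (E m) = E m := by
      refine (hEu _ _ fun d hd => ?_).symm
      have h1 := hE m ⟨star d, star_mem hd⟩
      rw [← star_inj, ← vecFun_star, ← vecFun_star, star_mul, star_mul, star_star,
        (IsSelfAdjoint.of_nonneg hm).star_eq, hM _ m.2 _ (hDM hd),
        hDc _ (star_mem (E m).2) _ hd] at h1
      exact h1
    refine nonneg_of_norm_sub_le congr(Subtype.val $hsa) (c := ‖(m : H →L[ℂ] H)‖) ?_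
    refine le_trans ?_ (norm_sub_le_of_nonneg hm)
    have h1 := hEn ((‖(m : H →L[ℂ] H)‖ : ℂ) • 1 - m)
    have h2 : E ((‖(m : H →L[ℂ] H)‖ : ℂ) • 1 - m) = (‖(m : H →L[ℂ] H)‖ : ℂ) • 1 - E m := by
      change E' _ = _
      rw [map_sub, map_smul]
      change _ • E 1 - _ = _
      rw [show E 1 = 1 from hcoe 1]
      rfl
    rw [h2] at h1
    exact h1
  · refine hEu _ _ fun d hd => ?_
    have h1 := hE m ⟨d * d₁ * d₂, mul_mem (mul_mem hd d₁.2) d₂.2⟩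
    simp only [MulMemClass.coe_mul, mul_assoc] at h1 ⊢
    rw [hM _ m.2 _ (hDM d₂.2), h1, hDc _ d₂.2 _ (E m).2]
    rfl
  · refine continuous_induced_rng.2 (continuous_iInf_rng.2 fun u => continuous_iInf_rng.2 fun v =>
      continuous_induced_rng.2 ?_)
    obtain ⟨y₁, x₁, y₂, x₂, h⟩ := exists_vecFun_comp M D hM hDM z hz0 E (fun d m => hE m d) v u
    have h1 : ((fun T : H →L[ℂ] H => ∑' n, ⟪v n, T (u n)⟫_ℂ) ∘
        (fun x : D => (x : H →L[ℂ] H)) ∘ E') =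
        fun m : M => vecFun y₁ x₁ (m : H →L[ℂ] H) + vecFun y₂ x₂ (m : H →L[ℂ] H) := by
      funext m
      rw [← h m, vecFun_eq_tsum]
      rfl
    rw [h1]
    exact @Continuous.add _ _ _ _ _ (ultraweakOn M) _ _ (continuous_vecFun M y₁ x₁)
      (continuous_vecFun M y₂ x₂)
  · refine hEu m e fun d hd => ?_
    have h1 := h ⟨d, hd⟩
    rw [hz, hz] at h1
    exact h1

/-! ### A faithful normal state on a σ-finite algebra. -/

/-- The closed subspace generated by a vector under the commutant of a von Neumann algebra. -/
noncomputable def cyclicSubspace (D : VonNeumannAlgebra H) (ξ : H) : Submodule ℂ H :=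
  (D.commutant.toStarSubalgebra.toSubalgebra.toSubmodule.map
    ((ContinuousLinearMap.apply ℂ H ξ : (H →L[ℂ] H) →L[ℂ] H) : (H →L[ℂ] H) →ₗ[ℂ]
      H)).topologicalClosure

instance (D : VonNeumannAlgebra H) (ξ : H) : CompleteSpace (cyclicSubspace D ξ) :=
  (Submodule.isClosed_topologicalClosure _).completeSpace_coe

theorem cyclicSubspace_le (D : VonNeumannAlgebra H) (ξ : H) {V : Submodule ℂ H}
    (hV : IsClosed (V : Set H)) (h : ∀ a ∈ D.commutant, a ξ ∈ V) : cyclicSubspace D ξ ≤ V := by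
  refine Submodule.topologicalClosure_minimal _ ?_ hV
  rintro _ ⟨a, ha, rfl⟩
  exact h a ha

theorem apply_mem_cyclicSubspace (D : VonNeumannAlgebra H) (ξ : H) {a : H →L[ℂ] H}
    (ha : a ∈ D.commutant) : a ξ ∈ cyclicSubspace D ξ :=
  Submodule.le_topologicalClosure _ ⟨a, ha, rfl⟩

theorem mem_cyclicSubspace (D : VonNeumannAlgebra H) (ξ : H) : ξ ∈ cyclicSubspace D ξ :=
  apply_mem_cyclicSubspace D ξ (one_mem D.commutant)

/-- The subspace is invariant under the commutant of `D`, so its projection lies in the bicommutant.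
-/
theorem starProjection_cyclicSubspace_mem (D : VonNeumannAlgebra H) (ξ : H) :
    (cyclicSubspace D ξ).starProjection ∈ D := by
  rw [IsStarProjection.mem_iff isStarProjection_starProjection]
  intro b hb
  rw [Submodule.range_starProjection]
  have h1 : cyclicSubspace D ξ ≤ (cyclicSubspace D ξ).comap (b : H →ₗ[ℂ] H) := by
    refine cyclicSubspace_le D ξ ?_ fun a ha => ?_
    · exact (Submodule.isClosed_topologicalClosure _).preimage b.continuous
    · exact apply_mem_cyclicSubspace D ξ (mul_mem hb ha)
  exact h1

theorem isOrtho_cyclicSubspace (D : VonNeumannAlgebra H) {ξ η : H}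
    (h : ∀ a ∈ D.commutant, ⟪ξ, a η⟫_ℂ = 0) : cyclicSubspace D ξ ⟂ cyclicSubspace D η := by
  refine cyclicSubspace_le D ξ (Submodule.isClosed_orthogonal _) fun a ha => ?_
  have h1 : cyclicSubspace D η ≤ (ℂ ∙ a ξ)ᗮ := by
    refine cyclicSubspace_le D η (Submodule.isClosed_orthogonal _) fun b hb => ?_
    rw [Submodule.mem_orthogonal_singleton_iff_inner_right,
      ← ContinuousLinearMap.adjoint_inner_right, ← ContinuousLinearMap.star_eq_adjoint]
    exact h _ (mul_mem (star_mem ha) hb)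
  exact fun u hu => (Submodule.mem_orthogonal_singleton_iff_inner_left).1 (h1 hu)

/-- A `σ`-finite von Neumann algebra has a faithful normal state. -/
theorem exists_faithful_normalState [Nontrivial H] (D : VonNeumannAlgebra H)
    (hD : D.IsSigmaFinite) : ∃ τ : D →ₗ[ℂ] ℂ, IsNormalState D τ ∧ IsFaithful D τ := by
  -- Zorn: a maximal family of nonzero vectors with mutually orthogonal cyclic subspaces. Their
  -- projections lie in `D`, so σ-finiteness makes the family countable.
  obtain ⟨S, hS⟩ : ∃ S, Maximal (fun S : Set H => (∀ ξ ∈ S, ξ ≠ 0) ∧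
      S.Pairwise fun ξ η => ∀ a ∈ D.commutant, ⟪ξ, a η⟫_ℂ = 0) S := by
    refine zorn_subset {S : Set H | (∀ ξ ∈ S, ξ ≠ 0) ∧
      S.Pairwise fun ξ η => ∀ a ∈ D.commutant, ⟪ξ, a η⟫_ℂ = 0} fun c hc hchain => ?_
    refine ⟨⋃₀ c, ⟨?_, ?_⟩, fun s hs => Set.subset_sUnion_of_mem hs⟩
    · rintro ξ ⟨s, hs, hξ⟩
      exact (hc hs).1 ξ hξ
    · exact (Set.pairwise_sUnion hchain.directedOn).2 fun s hs => (hc hs).2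
  obtain ⟨hS0, hSp⟩ := hS.prop
  have hcount : S.Countable := by
    let P : H → H →L[ℂ] H := fun ξ => (cyclicSubspace D ξ).starProjection
    have hP0 : ∀ ξ ∈ S, P ξ ≠ 0 := fun ξ hξ h0 => hS0 ξ hξ <| by
      rw [← Submodule.starProjection_eq_self_iff.2 (mem_cyclicSubspace D ξ)]
      exact congr($h0 ξ)
    have hPp : ∀ ξ ∈ S, ∀ η ∈ S, ξ ≠ η → P ξ * P η = 0 := fun ξ hξ η hη hne =>
      (isOrtho_cyclicSubspace D (hSp hξ hη hne)).starProjection_comp_starProjection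
    have hinj : Set.InjOn P S := by
      intro ξ hξ η hη heq
      by_contra hne
      have h1 := hPp ξ hξ η hη hne
      rw [← heq, isStarProjection_starProjection.isIdempotentElem.eq] at h1
      exact hP0 ξ hξ h1
    refine Set.countable_of_injective_of_countable_image hinj (hD _ ?_ ?_)
    · rintro _ ⟨ξ, hξ, rfl⟩
      exact ⟨starProjection_cyclicSubspace_mem D ξ, isStarProjection_starProjection, hP0 ξ hξ⟩
    · rintro _ ⟨ξ, hξ, rfl⟩ _ ⟨η, hη, rfl⟩ hne
      exact hPp ξ hξ η hη fun h => hne (h ▸ rfl)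
  have : Countable S := hcount
  obtain ⟨w, hw0, r, hwr, -⟩ := NNReal.exists_pos_sum_of_countable one_ne_zero S
  -- The weights are chosen so that the squared norms are `w ξ`, which are positive and summable.
  have hmem : Memℓp (fun ξ : S => ((√(w ξ) / ‖(ξ : H)‖ : ℝ) : ℂ) • (ξ : H)) 2 := by
    rw [memℓp_two_iff]
    refine (NNReal.summable_coe.2 hwr.summable).congr fun ξ => ?_
    have h1 : ‖(ξ : H)‖ ≠ 0 := norm_ne_zero_iff.2 (hS0 _ ξ.2)
    rw [norm_smul, Complex.norm_of_nonneg (by positivity), div_mul_cancel₀ _ h1,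
      Real.sq_sqrt (NNReal.coe_nonneg _)]
  set z : lp (fun _ : S => H) 2 := ⟨_, hmem⟩ with hz
  have hfaith : ∀ d ∈ D, amp d z = 0 → d = 0 := by
    intro d hd h0
    have hdS : ∀ ξ ∈ S, d ξ = 0 := by
      intro ξ hξ
      have h1 : d (((√(w ⟨ξ, hξ⟩) / ‖ξ‖ : ℝ) : ℂ) • ξ) = 0 := congr($h0 ⟨ξ, hξ⟩)
      rw [map_smul, smul_eq_zero] at h1
      refine h1.resolve_left ?_
      have h2 := hw0 ⟨ξ, hξ⟩
      have h3 : 0 < ‖ξ‖ := norm_pos_iff.2 (hS0 ξ hξ)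
      exact_mod_cast (by positivity : √(w ⟨ξ, hξ⟩ : ℝ) / ‖ξ‖ ≠ 0)
    by_contra hne
    obtain ⟨η₀, hη₀⟩ : ∃ η, star d η ≠ 0 := by
      by_contra! hcon
      exact hne (star_eq_zero.1 (ContinuousLinearMap.ext hcon))
    have horth : ∀ ξ ∈ S, ∀ a ∈ D.commutant, ⟪star d η₀, a ξ⟫_ℂ = 0 := by
      intro ξ hξ a ha
      rw [ContinuousLinearMap.star_eq_adjoint, ContinuousLinearMap.adjoint_inner_left]
      have : d (a ξ) = a (d ξ) := congr($(mem_commutant_iff.1 ha d hd) ξ)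
      rw [this, hdS ξ hξ, map_zero, inner_zero_right]
    -- If `d` kills every vector of `S`, then `star d η₀` is orthogonal to all their cyclic
    -- subspaces. Maximality puts it in `S`, hence it is orthogonal to itself.
    have hins : star d η₀ ∈ S := by
      refine hS.le_of_ge (y := insert (star d η₀) S) ⟨?_, ?_⟩ (Set.subset_insert _ _)
        (Set.mem_insert _ _)
      · rintro ξ (rfl | hξ)
        · exact hη₀
        · exact hS0 ξ hξ
      · refine (Set.pairwise_insert).2 ⟨hSp, fun ξ hξ _ => ⟨horth ξ hξ, fun a ha => ?_⟩⟩
        rw [← inner_conj_symm, ← ContinuousLinearMap.adjoint_inner_right,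
          ← ContinuousLinearMap.star_eq_adjoint, horth ξ hξ _ (star_mem ha), map_zero]
    have h1 := horth _ hins 1 (one_mem _)
    exact hη₀ (inner_self_eq_zero.1 h1)
  have hz0 : z ≠ 0 := by
    intro h
    have : (1 : H →L[ℂ] H) = 0 := hfaith 1 (one_mem D) (by rw [amp_one, h])
    exact one_ne_zero this
  set z' : lp (fun _ : S => H) 2 := ((‖z‖ : ℂ)⁻¹) • z with hz'
  refine ⟨{ toFun := fun d => vecFun z' z' (d : H →L[ℂ] H)
            map_add' := fun a b => map_add (vecFun z' z') _ _
            map_smul' := fun c a => map_smul (vecFun z' z') _ _ }, ⟨?_, ?_, ?_⟩, ?_⟩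
  · change vecFun z' z' 1 = 1
    have h1 := vecFun_star_mul_self z' 1
    rw [star_one, one_mul, amp_one] at h1
    rw [h1, hz', norm_smul, norm_inv, Complex.norm_real, norm_norm,
      inv_mul_cancel₀ (norm_ne_zero_iff.2 hz0)]
    simp
  · exact fun m hm => vecFun_nonneg z' hm
  · exact continuous_vecFun D z' z'
  · intro d hd h0
    change vecFun z' z' (d : H →L[ℂ] H) = 0 at h0
    set b := CFC.sqrt (d : H →L[ℂ] H)
    have hbD : b ∈ D := sqrt_mem D d.2
    have hb : star b = b := IsSelfAdjoint.of_nonneg (CFC.sqrt_nonneg _)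
    have hbb : b * b = d := CFC.sqrt_mul_sqrt_self _ hd
    rw [← hbb] at h0
    nth_rw 1 [← hb] at h0
    rw [vecFun_star_mul_self] at h0
    have h1 : amp b z' = 0 := by simpa using h0
    rw [hz', amp_smul_right, smul_eq_zero] at h1
    have h2 := hfaith b hbD (h1.resolve_left (by simpa using hz0))
    apply Subtype.ext
    rw [← hbb, h2, zero_mul]
    rfl

end VonNeumannAlgebra

/-! ### The equivalence. -/

open VonNeumannAlgebra in
theorem mainTheorem12 {H : Type*} [NormedAddCommGroup H] [InnerProductSpace ℂ H] [CompleteSpace H]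
    [Nontrivial H]
    (M D : VonNeumannAlgebra H) (hM : ∀ x ∈ M, ∀ y ∈ M, x * y = y * x)
    (hDM : D ≤ M) (hD : D.IsSigmaFinite)
    (A : Subalgebra ℂ (H →L[ℂ] H)) (hAM : ∀ x ∈ A, x ∈ M) (hDA : ∀ x ∈ D, x ∈ A)
    (hA : IsClosed[ultraweak H] (A : Set (H →L[ℂ] H)))
    (Φ : A →ₗ[ℂ] D) (hΦ_one : Φ 1 = 1)
    (hΦ_bimodule : ∀ (d₁ d₂ : D) (a : A),
      Φ (⟨d₁, hDA d₁ d₁.2⟩ * a * ⟨d₂, hDA d₂ d₂.2⟩) = d₁ * Φ a * d₂)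
    (hΦ_cont : Continuous[ultraweakOn A, ultraweakOn D] Φ) :
    ((∃ E : M →ₗ[ℂ] D, IsNormalCondExp M D hDM E ∧ ∀ a : A, E ⟨a, hAM a a.2⟩ = Φ a) ↔
      ∃ τ : D →ₗ[ℂ] ℂ, IsNormalState D τ ∧ IsFaithful D τ ∧
        ∃ ψ : M →ₗ[ℂ] ℂ, IsNormalState M ψ ∧ ∀ a : A, ψ ⟨a, hAM a a.2⟩ = τ (Φ a)) ∧
    ((∃ E : M →ₗ[ℂ] D, IsNormalCondExp M D hDM E ∧ ∀ a : A, E ⟨a, hAM a a.2⟩ = Φ a) ↔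
      ∀ τ : D →ₗ[ℂ] ℂ, IsNormalState D τ → IsFaithful D τ →
        ∃ ψ : M →ₗ[ℂ] ℂ, IsNormalState M ψ ∧ ∀ a : A, ψ ⟨a, hAM a a.2⟩ = τ (Φ a)) := by
  have hleft : ∀ (d : D) (a : A), Φ (⟨d, hDA d d.2⟩ * a) = d * Φ a := by
    intro d a
    have h1 := hΦ_bimodule d 1 a
    rw [mul_one] at h1
    rw [← h1]
    congr 1
  have hΦD : ∀ d : D, Φ ⟨d, hDA d d.2⟩ = d := by
    intro d
    have h1 := hleft d 1
    rwa [mul_one, hΦ_one, mul_one] at h1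
  have extend : (∃ E : M →ₗ[ℂ] D, IsNormalCondExp M D hDM E ∧ ∀ a : A, E ⟨a, hAM a a.2⟩ = Φ a) →
      ∀ τ : D →ₗ[ℂ] ℂ, IsNormalState D τ → IsFaithful D τ →
        ∃ ψ : M →ₗ[ℂ] ℂ, IsNormalState M ψ ∧ ∀ a : A, ψ ⟨a, hAM a a.2⟩ = τ (Φ a) := by
    rintro ⟨E, hE, hEΦ⟩ τ hτ -
    refine ⟨τ ∘ₗ E, ⟨?_, fun m hm => hτ.map_nonneg _ (hE.map_nonneg m hm), ?_⟩, fun a => ?_⟩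
    · have h1 : E 1 = 1 := hE.map_coe 1
      rw [LinearMap.comp_apply, h1, hτ.map_one]
    · exact @Continuous.comp _ _ _ (ultraweakOn M) (ultraweakOn D) _ _ _ hτ.continuous hE.continuous
    · rw [LinearMap.comp_apply, hEΦ]
  have construct : (∃ τ : D →ₗ[ℂ] ℂ, IsNormalState D τ ∧ IsFaithful D τ ∧
        ∃ ψ : M →ₗ[ℂ] ℂ, IsNormalState M ψ ∧ ∀ a : A, ψ ⟨a, hAM a a.2⟩ = τ (Φ a)) →
      ∃ E : M →ₗ[ℂ] D, IsNormalCondExp M D hDM E ∧ ∀ a : A, E ⟨a, hAM a a.2⟩ = Φ a := by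
    rintro ⟨τ, -, hτf, ψ, hψ, hψΦ⟩
    have hψD : ∀ d : D, ψ ⟨d, hDM d.2⟩ = τ d := fun d => by
      rw [← congr(τ $(hΦD d)), ← hψΦ]
    obtain ⟨E, hE, hEu⟩ := exists_normalCondExp M D hM hDM hψ fun d hd h0 =>
      hτf d hd (by rw [← hψD, h0])
    refine ⟨E, hE, fun a => hEu _ _ fun d => ?_⟩
    -- `ψ(d a) = τ(Φ(d a)) = τ(d Φ(a)) = ψ(d Φ(a))`, the identity that characterises `E a`.
    have h1 := hψΦ (⟨d, hDA d d.2⟩ * a)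
    rw [hleft, ← hψD] at h1
    exact h1
  refine ⟨⟨fun h => ?_, construct⟩, extend, fun h => construct ?_⟩
  · obtain ⟨τ, hτ, hτf⟩ := exists_faithful_normalState D hD
    exact ⟨τ, hτ, hτf, extend h τ hτ hτf⟩
  · obtain ⟨τ, hτ, hτf⟩ := exists_faithful_normalState D hD
    exact ⟨τ, hτ, hτf, h τ hτ hτf⟩
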